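/- All graphs are finite, undirected and simple. Let $G=(V,E)$ be a graph and write $N(v)$ for the set of neighbors of a vertex $v$. A \emph{neighborhood system} for $G$ is a family $\Sigma=(\Sigma(v))_{v\in V}$ with $\Sigma(v)\subseteq N(v)$ for every $v\in V$. Let $\rho(\Sigma)=\max_{v\in V}|\Sigma(v)|$, and let $G_\Sigma$ be the graph with vertex set $V$ in which two distinct vertices $u,v$ are adjacent if and only if they have a common neighbor $w$ in $G$ with $\{u,v\}\subseteq\Sigma(w)$. Let $\mathrm{mad}(\Sigma)$ be the maximum average degree $2|E(H)|/|V(H)|$ over all subgraphs $H$ of $G_\Sigma$ with at least one vertex. (If $V=\emptyset$, both maxima are $0$.) The \emph{arrangeability} of $G$ is the least integer $k\ge 0$ for which there is a linear ordering $\prec$ of $V$ such that for each vertex $v$ there are at most $k$ vertices $x\prec v$ that have a common neighbor $w$ with $v$ such that $v\prec w$. A class of graphs has \emph{bounded arrangeability} if there is a constant $k$ such that every graph in the class has arrangeability at most $k$. \textbf{Theorem.} Let $\mathcal{F}$ be a class of graphs. The following statements are equivalent: (i) There is a constant $C_{\mathcal F}$ such that every $G\in\mathcal F$ and every neighborhood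 system $\Sigma$ for $G$ satisfy $\mathrm{mad}(\Sigma)\le C_{\mathcal F}\cdot\rho(\Sigma)$. (ii) There is a function $f_{\mathcal F}$ such that every $G\in\mathcal F$ and every neighborhood system $\Sigma$ for $G$ satisfy $\mathrm{mad}(\Sigma)\le f_{\mathcal F}(\rho(\Sigma))$. (iii) The supremum of $\mathrm{mad}(\Sigma)$ over all graphs $G\in\mathcal F$ and all neighborhood systems $\Sigma$ for $G$ with $\rho(\Sigma)=2$ is finite. (iv) $\mathcal F$ has bounded arrangeability. -/

import Mathlib

universe u

noncomputable section

/-- A finite undirected simple graph, bundled with its vertex type. A class of graphs is a set of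
such objects. -/
structure FinGraph where
  V : Type u
  [finite : Finite V]
  graph : SimpleGraph V

/-- A neighborhood system for `G`: a set `Σ(v) ⊆ N(v)` for every vertex `v`. -/
structure NeighborhoodSystem {V : Type u} (G : SimpleGraph V) where
  nbhd : V → Set V
  subset_neighborSet : ∀ v, nbhd v ⊆ G.neighborSet v

namespace NeighborhoodSystem

variable {V : Type u} {G : SimpleGraph V}

/-- The graph `G_Σ` on the vertex set of `G`: two distinct vertices `u` and `v` are adjacent if
they have a common neighbor `w` in `G` with `{u, v} ⊆ Σ(w)`. -/
def toGraph (S : NeighborhoodSystem G) : SimpleGraph V where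
  Adj u v := u ≠ v ∧ ∃ w, w ∈ G.commonNeighbors u v ∧ {u, v} ⊆ S.nbhd w
  symm := ⟨fun _ _ h => ⟨h.1.symm, by
    obtain ⟨w, hw, hs⟩ := h.2
    exact ⟨w, by rwa [SimpleGraph.commonNeighbors_symm], by rwa [Set.pair_comm]⟩⟩⟩
  loopless := ⟨fun _ h => h.1 rfl⟩

/-- `ρ(Σ)`, the maximum size of a set `Σ(v)` (and `0` if there are no vertices). It is used for
finite graphs only, where the supremum is a maximum. -/
def rho (S : NeighborhoodSystem G) : ℕ := ⨆ v, (S.nbhd v).ncard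

end NeighborhoodSystem

/-- The average degree `2|E(H)| / |V(H)|` of a subgraph `H` of a graph. -/
def averageDegree {V : Type u} {G : SimpleGraph V} (H : G.Subgraph) : ℝ :=
  2 * (H.edgeSet.ncard : ℝ) / (H.verts.ncard : ℝ)

/-- The maximum average degree over all subgraphs of `G` with at least one vertex (and `0` if `G`
has no vertices). It is used for finite graphs only, where the supremum is a maximum. -/
def maxAverageDegree {V : Type u} (G : SimpleGraph V) : ℝ :=
  sSup {d : ℝ | ∃ H : G.Subgraph, H.verts.Nonempty ∧ averageDegree H = d}

/-- `mad(Σ)`, the maximum average degree of `G_Σ`. -/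
def NeighborhoodSystem.mad {V : Type u} {G : SimpleGraph V} (S : NeighborhoodSystem G) : ℝ :=
  maxAverageDegree S.toGraph

/-- There is a linear ordering of the vertices such that, for each vertex `v`, there are at most
`k` vertices `x` smaller than `v` that have with `v` a common neighbor `w` larger than `v`. -/
def IsArrangeable {V : Type u} (G : SimpleGraph V) (k : ℕ) : Prop :=
  ∃ L : LinearOrder V, ∀ v : V,
    {x : V | L.lt x v ∧ ∃ w ∈ G.commonNeighbors x v, L.lt v w}.ncard ≤ k

/-- The arrangeability of a finite graph: the least `k` such that `G` is `k`-arrangeable. -/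
def arrangeability {V : Type u} (G : SimpleGraph V) : ℕ :=
  sInf {k : ℕ | IsArrangeable G k}

/-- A class of graphs has bounded arrangeability if some constant bounds the arrangeability of
all of its members. -/
def HasBoundedArrangeability (F : Set FinGraph.{u}) : Prop :=
  ∃ k : ℕ, ∀ G ∈ F, arrangeability G.graph ≤ k

end

/-! The steps (i) → (ii) → (iii) are immediate. For (iv) → (i), fix a `k`-arrangeable ordering and
an edge `u < v` of `G_Σ` witnessed by `w`. If `v < w`, arrangeability leaves at most `k` choices of
`u`. If `w < v`, then `w` is one of at most `k + 1` smaller neighbors of `v` and `u ∈ Σ(w)`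
(`IsArrangeable.mad_le`). For (iii) → (iv), systems with `ρ = 2` amount to assigning a pair of
neighbors to each vertex, so (iii) yields `PairBound`. This bounds the degeneracy of `G`, and also
the number of pairs in `R` with a common neighbor outside `R`, provided outside vertices have few
neighbors in `R`. Averaging then gives a vertex of `R` that can be placed last in `R`
(`PairBound.exists_next`), and the ordering is built from the top down. -/

open Finset Classical in
/-- Whenever distinct ordered pairs of distinct vertices of `A` are assigned to the vertices of `W`,
such that each vertex of `W` is adjacent to both entries of its pair, `W` has at most `c * |A|`
elements. -/
def PairBound {V : Type u} (G : SimpleGraph V) (c : ℕ) : Prop :=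
  ∀ (A W : Finset V) (f : V → V × V), Set.InjOn f W →
    (∀ w ∈ W, (f w).1 ≠ (f w).2 ∧ (f w).1 ∈ A ∧ (f w).2 ∈ A ∧ G.Adj w (f w).1 ∧ G.Adj w (f w).2) →
    W.card ≤ c * A.card

/-! ### Degeneracy from the pair bound -/

section Counting

open Finset Classical

variable {V : Type u} {G : SimpleGraph V} {c : ℕ}

/-- The choice is greedy. If all pairs from the neighborhood `B` of `w` in `A` were taken, the pair
bound on `B` itself would give `|B|(|B| - 1) ≤ c|B|`, contradicting `|B| ≥ c + 2`. -/
theorem PairBound.exists_injOn (h : PairBound G c) (A W : Finset V)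
    (hW : ∀ w ∈ W, c + 2 ≤ (A.filter (G.Adj w)).card) :
    ∃ f : V → V × V, Set.InjOn f W ∧
      ∀ w ∈ W, (f w).1 ≠ (f w).2 ∧ (f w).1 ∈ A ∧ (f w).2 ∈ A ∧
        G.Adj w (f w).1 ∧ G.Adj w (f w).2 := by
  induction W using Finset.induction_on with
  | empty => exact ⟨fun v => (v, v), by simp, by simp⟩
  | insert w W hw ih =>
    obtain ⟨f, hf, hfW⟩ := ih fun x hx => hW x (mem_insert_of_mem hx)
    set B := A.filter (G.Adj w) with hB
    have hBc : c + 2 ≤ B.card := hW w (mem_insert_self _ _)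
    have hne : ∃ e ∈ B.offDiag, e ∉ W.image f := by
      by_contra! hcon
      have hle : B.offDiag.card ≤ c * B.card := by
        have h1 : B.offDiag ⊆ (W.filter fun x => f x ∈ B.offDiag).image f := by
          intro e he
          obtain ⟨x, hx, rfl⟩ := mem_image.1 (hcon e he)
          exact mem_image_of_mem _ (mem_filter.2 ⟨hx, he⟩)
        refine (card_le_card h1).trans (card_image_le.trans ?_)
        refine h B _ f (hf.mono fun x hx => (mem_filter.1 hx).1) fun x hx => ?_
        obtain ⟨hx, hxB⟩ := mem_filter.1 hx
        obtain ⟨h1, h2, h3⟩ := mem_offDiag.1 hxB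
        exact ⟨h3, h1, h2, (hfW x hx).2.2.2⟩
      rw [offDiag_card] at hle
      have h2 : (c + 2) * B.card ≤ B.card * B.card := Nat.mul_le_mul_right _ hBc
      have h3 : (c + 2) * B.card = c * B.card + 2 * B.card := by ring
      omega
    obtain ⟨e, he, heW⟩ := hne
    obtain ⟨he1, he2, he3⟩ := mem_offDiag.1 he
    have hupd : ∀ x ∈ W, Function.update f w e x = f x := fun x hx =>
      Function.update_of_ne (ne_of_mem_of_not_mem hx hw) _ _
    refine ⟨Function.update f w e, ?_, fun x hx => ?_⟩
    · rw [coe_insert, Set.injOn_insert (by simpa using hw)]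
      refine ⟨fun x hx y hy hxy => hf hx hy ?_, ?_⟩
      · rwa [hupd x hx, hupd y hy] at hxy
      · rintro ⟨x, hx, hxe⟩
        rw [hupd x hx, Function.update_self] at hxe
        exact heW (mem_image.2 ⟨x, hx, hxe⟩)
    · rcases mem_insert.1 hx with rfl | hx
      · rw [Function.update_self]
        rw [hB, mem_filter] at he1 he2
        exact ⟨he3, he1.1, he2.1, he1.2, he2.2⟩
      · rw [hupd x hx]
        exact hfW x hx

theorem PairBound.card_le_of_many_neighbors (h : PairBound G c) (A W : Finset V)
    (hW : ∀ w ∈ W, c + 2 ≤ (A.filter (G.Adj w)).card) : W.card ≤ c * A.card := by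
  obtain ⟨f, hf, hfW⟩ := h.exists_injOn A W hW
  exact h A W f hf hfW

/-- A set `A ⊆ R` such that few edges of `G[R]` are incident with the vertices that have fewer than
`s` neighbors in `A`. -/
theorem exists_subset_sum_degree_le (G : SimpleGraph V) (R : Finset V) (s t : ℕ) :
    ∃ A ⊆ R, t * A.card ≤ s * R.card ∧
      ∑ w ∈ R.filter (fun w => (A.filter (G.Adj w)).card < s), (R.filter (G.Adj w)).card ≤
        (t + s) * R.card := by
  obtain ⟨A, hA, hmax⟩ := exists_max_image R.powerset
    (fun A => ((∑ w ∈ R, min s (A.filter (G.Adj w)).card : ℕ) : ℤ) - t * (A.card : ℤ))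
    ⟨∅, by simp⟩
  have hAR := mem_powerset.1 hA
  set U := R.filter (fun w => (A.filter (G.Adj w)).card < s) with hU
  refine ⟨A, hAR, ?_, ?_⟩
  · have h0 := hmax ∅ (by simp)
    have h1 : ∑ w ∈ R, min s (A.filter (G.Adj w)).card ≤ R.card * s :=
      sum_le_card_nsmul _ _ _ fun w _ => min_le_left _ _
    simp only [filter_empty, card_empty, Nat.min_zero, sum_const_zero, Nat.cast_zero, mul_zero,
      sub_zero] at h0
    zify at h1 ⊢
    push_cast at h0
    linarith
  · have hv : ∀ v ∈ R \ A, (U.filter fun w => G.Adj w v).card ≤ t := by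
      intro v hv
      obtain ⟨hvR, hvA⟩ := mem_sdiff.1 hv
      have h0 := hmax (insert v A) (mem_powerset.2 (insert_subset hvR hAR))
      have h1 : ∑ w ∈ R, min s ((insert v A).filter (G.Adj w)).card =
          ∑ w ∈ R, min s (A.filter (G.Adj w)).card + (U.filter fun w => G.Adj w v).card := by
        rw [hU, filter_filter, card_filter, ← sum_add_distrib]
        refine sum_congr rfl fun w _ => ?_
        rw [filter_insert]
        by_cases hwv : G.Adj w v
        · rw [if_pos hwv, card_insert_of_notMem (by simp [hvA])]
          simp only [hwv, and_true]
          split_ifs <;> omega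
        · simp [hwv]
      simp only [h1, card_insert_of_notMem hvA] at h0
      push_cast at h0
      zify
      linarith
    have h2 : ∑ w ∈ U, ((R \ A).filter (G.Adj w)).card ≤ t * R.card := by
      have := sum_card_bipartiteAbove_eq_sum_card_bipartiteBelow (s := U) (t := R \ A) G.Adj
      simp only [bipartiteAbove, bipartiteBelow] at this
      rw [this]
      calc _ ≤ (R \ A).card * t := sum_le_card_nsmul _ _ _ hv
        _ ≤ R.card * t := Nat.mul_le_mul_right _ (card_le_card sdiff_subset)
        _ = _ := mul_comm _ _
    have h3 : ∑ w ∈ U, (A.filter (G.Adj w)).card ≤ s * R.card :=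
      calc _ ≤ U.card * s := sum_le_card_nsmul _ _ _ fun w hw => (mem_filter.1 hw).2.le
        _ ≤ R.card * s := Nat.mul_le_mul_right _ (card_le_card (filter_subset _ _))
        _ = _ := mul_comm _ _
    calc _ ≤ ∑ w ∈ U, (((R \ A).filter (G.Adj w)).card + (A.filter (G.Adj w)).card) := by
          refine sum_le_sum fun w _ => ?_
          rw [← card_union_of_disjoint (disjoint_filter_filter sdiff_disjoint), ← filter_union,
            sdiff_union_of_subset hAR]
      _ ≤ (t + s) * R.card := by rw [sum_add_distrib, add_mul]; exact add_le_add h2 h3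

/-- The degeneracy of a graph with `PairBound G c`. -/
def degeneracyBound (c : ℕ) : ℕ := 2 * (4 * c * (c + 2) + (c + 2))

theorem PairBound.exists_degree_le (h : PairBound G c) {R : Finset V} (hR : R.Nonempty) :
    ∃ v ∈ R, (R.filter (G.Adj v)).card ≤ degeneracyBound c := by
  by_contra! hcon
  -- With this `t`, the saturated vertices number at most `c|A| ≤ |R|/4`. If all degrees exceeded
  -- `2(t + s)`, the unsaturated ones would number at most `|R|/2`, so together they would not fill
  -- `R`.
  obtain ⟨A, -, h1, h2⟩ := exists_subset_sum_degree_le G R (c + 2) (4 * c * (c + 2))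
  set U := R.filter (fun w => (A.filter (G.Adj w)).card < c + 2) with hU
  have h3 : (R \ U).card ≤ c * A.card := by
    refine h.card_le_of_many_neighbors A _ fun w hw => ?_
    simp only [hU, mem_sdiff, mem_filter, not_and, not_lt] at hw
    exact hw.2 hw.1
  have h4 : U.card * degeneracyBound c ≤ (4 * c * (c + 2) + (c + 2)) * R.card :=
    (card_nsmul_le_sum _ _ _ fun w hw => (hcon w (filter_subset _ _ hw)).le).trans h2
  have h5 : U.card * 2 ≤ R.card := by
    refine Nat.le_of_mul_le_mul_left (c := 4 * c * (c + 2) + (c + 2)) ?_ (by positivity)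
    calc _ = U.card * degeneracyBound c := by unfold degeneracyBound; ring
      _ ≤ _ := h4
  have h6 : 4 * (c * A.card) ≤ R.card := by
    refine Nat.le_of_mul_le_mul_left (c := c + 2) ?_ (by positivity)
    calc _ = 4 * c * (c + 2) * A.card := by ring
      _ ≤ _ := h1
  have h7 : (R \ U).card + U.card = R.card := card_sdiff_add_card_eq_card (filter_subset _ _)
  have h8 := hR.card_pos
  omega

theorem PairBound.sum_degree_le (h : PairBound G c) (R : Finset V) :
    ∑ v ∈ R, (R.filter (G.Adj v)).card ≤ 2 * degeneracyBound c * R.card := by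
  induction R using Finset.strongInduction with
  | H R ih =>
    rcases R.eq_empty_or_nonempty with rfl | hR
    · simp
    obtain ⟨v, hv, hd⟩ := h.exists_degree_le hR
    have h1 := ih (R.erase v) (erase_ssubset hv)
    have h2 : ∀ w ∈ R.erase v, (R.filter (G.Adj w)).card =
        ((R.erase v).filter (G.Adj w)).card + if G.Adj v w then 1 else 0 := by
      intro w _
      rw [filter_erase]
      split_ifs with hvw
      · rw [card_erase_add_one (mem_filter.2 ⟨hv, hvw.symm⟩)]
      · rw [erase_eq_of_notMem (by simp [hv, G.adj_comm w v, hvw]), add_zero]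
    have h3 : ∑ w ∈ R.erase v, (if G.Adj v w then 1 else 0) ≤ (R.filter (G.Adj v)).card := by
      rw [← card_filter]
      exact card_le_card (filter_subset_filter _ (erase_subset _ _))
    rw [← add_sum_erase _ _ hv, sum_congr rfl h2, sum_add_distrib]
    have h4 := card_erase_add_one hv
    rw [← h4, mul_add, mul_one]
    omega

/-- Send each pair to one of its common neighbors in `W`. Fibers have at most `D²` elements, and
picking one pair per fiber gives an injective assignment to which the pair bound applies. -/
theorem PairBound.card_pairs_le (h : PairBound G c) (R W : Finset V) (D : ℕ)
    (hD : ∀ w ∈ W, (R.filter (G.Adj w)).card ≤ D) :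
    ((R ×ˢ R).filter fun p => p.1 ≠ p.2 ∧ ∃ w ∈ W, G.Adj w p.1 ∧ G.Adj w p.2).card ≤
      D * D * (c * R.card) := by
  set Q := (R ×ˢ R).filter fun p => p.1 ≠ p.2 ∧ ∃ w ∈ W, G.Adj w p.1 ∧ G.Adj w p.2 with hQ
  have hw : ∀ p ∈ Q, ∃ w ∈ W, G.Adj w p.1 ∧ G.Adj w p.2 := fun p hp => (mem_filter.1 hp).2.2
  rcases Q.eq_empty_or_nonempty with hQe | ⟨p₀, hp₀⟩
  · simp [hQe]
  have : ∀ p : V × V, ∃ w, p ∈ Q → w ∈ W ∧ G.Adj w p.1 ∧ G.Adj w p.2 := by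
    intro p
    by_cases hp : p ∈ Q
    · obtain ⟨w, hw⟩ := hw p hp
      exact ⟨w, fun _ => hw⟩
    · exact ⟨p.1, fun hp' => absurd hp' hp⟩
  choose g hg using this
  have h1 : Q.card ≤ D * D * (Q.image g).card := by
    refine card_le_mul_card_image Q _ fun w hw => ?_
    obtain ⟨q, hq, rfl⟩ := mem_image.1 hw
    have hsub : Q.filter (fun p => g p = g q) ⊆
        R.filter (G.Adj (g q)) ×ˢ R.filter (G.Adj (g q)) := by
      intro p hp
      obtain ⟨hp, hpq⟩ := mem_filter.1 hp
      have hR := mem_product.1 (mem_filter.1 hp).1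
      rw [← hpq]
      exact mem_product.2 ⟨mem_filter.2 ⟨hR.1, (hg p hp).2.1⟩, mem_filter.2 ⟨hR.2, (hg p hp).2.2⟩⟩
    refine (card_le_card hsub).trans ?_
    rw [card_product]
    exact Nat.mul_le_mul (hD _ (hg q hq).1) (hD _ (hg q hq).1)
  have : ∀ w, ∃ p, w ∈ Q.image g → p ∈ Q ∧ g p = w := by
    intro w
    by_cases hw : w ∈ Q.image g
    · obtain ⟨p, hp⟩ := mem_image.1 hw
      exact ⟨p, fun _ => hp⟩
    · exact ⟨p₀, fun hw' => absurd hw' hw⟩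
  choose f hf using this
  refine h1.trans (Nat.mul_le_mul_left _ (h R _ f ?_ fun w hw => ?_))
  · intro w hw w' hw' hww
    rw [← (hf w hw).2, ← (hf w' hw').2, hww]
  · obtain ⟨hfQ, hgf⟩ := hf w hw
    obtain ⟨hR, hne, -⟩ := mem_filter.1 hfQ
    have := (hg _ hfQ).2
    rw [hgf] at this
    exact ⟨hne, (mem_product.1 hR).1, (mem_product.1 hR).2, this.1, this.2⟩

/-! ### Greedy construction of the ordering from the top -/

/-- The bound on the number of back-neighbors in the ordering constructed greedily. -/
def backDegreeBound (c : ℕ) : ℕ := 4 * degeneracyBound c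

/-- The bound on the arrangeability of a graph with `PairBound G c`. -/
def arrangeabilityBound (c : ℕ) : ℕ := 2 * (backDegreeBound c * backDegreeBound c * c)

/-- Both thresholds are twice the corresponding average bounds. At most half of `R` violates the
first and, if no vertex satisfies both, the rest violates the second, which is less than half. -/
theorem PairBound.exists_next [Fintype V] (h : PairBound G c) {R : Finset V} (hR : R.Nonempty)
    (hD : ∀ w ∉ R, (R.filter (G.Adj w)).card ≤ backDegreeBound c) :
    ∃ v ∈ R, (R.filter (G.Adj v)).card ≤ backDegreeBound c ∧
      (R.filter fun x => x ≠ v ∧ ∃ w ∉ R, G.Adj w x ∧ G.Adj w v).card ≤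
        arrangeabilityBound c := by
  by_contra! hcon
  have h1 := h.sum_degree_le R
  have h2 := h.card_pairs_le R Rᶜ (backDegreeBound c) fun w hw => hD w (mem_compl.1 hw)
  set X := R.filter fun v => backDegreeBound c < (R.filter (G.Adj v)).card with hX
  set B := backDegreeBound c * backDegreeBound c * c with hB
  set r : V → ℕ := fun v => (R.filter fun x => x ≠ v ∧ ∃ w ∉ R, G.Adj w x ∧ G.Adj w v).card
  have h3 : ∑ v ∈ R, r v ≤ B * R.card := by
    have h4 : ∑ v ∈ R, r v = ((R ×ˢ R).filter fun p =>
        p.1 ≠ p.2 ∧ ∃ w ∈ Rᶜ, G.Adj w p.1 ∧ G.Adj w p.2).card := by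
      simp only [r, card_filter, sum_product_right, mem_compl]
    rw [h4]
    exact h2.trans_eq (by rw [hB]; ring)
  have h5 : X.card * (backDegreeBound c + 1) ≤ 2 * degeneracyBound c * R.card :=
    ((card_nsmul_le_sum X _ _ fun v hv => (mem_filter.1 hv).2).trans
      (sum_le_sum_of_subset (filter_subset _ _))).trans h1
  have h6 : (R \ X).card * (2 * B + 1) ≤ B * R.card := by
    refine ((card_nsmul_le_sum (R \ X) r _ fun v hv => ?_).trans
      (sum_le_sum_of_subset sdiff_subset)).trans h3
    simp only [hX, mem_sdiff, mem_filter, not_and, not_lt] at hv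
    exact hcon v hv.1 (hv.2 hv.1)
  have h7 : (R \ X).card + X.card = R.card := card_sdiff_add_card_eq_card (filter_subset _ _)
  have h8 := hR.card_pos
  have h9 : 0 < degeneracyBound c := by unfold degeneracyBound; positivity
  have h10 : 2 * X.card ≤ R.card := by
    refine Nat.le_of_mul_le_mul_left (c := 2 * degeneracyBound c) ?_ (by positivity)
    unfold backDegreeBound at h5
    nlinarith
  -- For `B = 0` there is no factor to cancel, but then `h6` makes `R \ X` empty.
  rcases Nat.eq_zero_or_pos B with hB0 | hB0
  · rw [hB0] at h6
    omega
  · have h11 : 2 * (R \ X).card + 1 ≤ R.card := by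
      by_contra! hlt
      have h12 : R.card ≤ 2 * (R \ X).card := by omega
      have := Nat.mul_le_mul_left B h12
      nlinarith
    omega

/-- `R` holds the vertices not yet placed; those outside lie above all of `R`. Ranks outside `R` are
meaningless, hence the alternative `w ∉ R`. The degree hypothesis is the invariant needed by
`PairBound.exists_next`, whose first conclusion preserves it. -/
theorem PairBound.exists_rank [Fintype V] (h : PairBound G c) (n : ℕ) :
    ∀ R : Finset V, R.card = n →
      (∀ w ∉ R, (R.filter (G.Adj w)).card ≤ backDegreeBound c) →
      ∃ r : V → ℕ, Set.InjOn r R ∧ (∀ v ∈ R, r v < n) ∧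
        ∀ v ∈ R, (R.filter fun x => r x < r v ∧
          ∃ w, G.Adj w x ∧ G.Adj w v ∧ (w ∉ R ∨ r v < r w)).card ≤ arrangeabilityBound c := by
  induction n with
  | zero =>
    intro R hR _
    rw [card_eq_zero.1 hR]
    exact ⟨fun _ => 0, by simp, by simp, by simp⟩
  | succ n ih =>
    intro R hR hD
    obtain ⟨v, hv, hv1, hv2⟩ := h.exists_next (card_pos.1 (by omega)) hD
    obtain ⟨r, hr1, hr2, hr3⟩ := ih (R.erase v) (by rw [card_erase_of_mem hv, hR]; rfl) (by
      intro w hw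
      refine (card_le_card (filter_subset_filter _ (erase_subset _ _))).trans ?_
      by_cases hwv : w = v
      · rwa [hwv]
      · exact hD w fun hwR => hw (mem_erase.2 ⟨hwv, hwR⟩))
    have hupd : ∀ x, x ≠ v → Function.update r v n x = r x := fun x hx =>
      Function.update_of_ne hx _ _
    have hlt : ∀ x ∈ R, x ≠ v → r x < n := fun x hx hxv => hr2 x (mem_erase.2 ⟨hxv, hx⟩)
    refine ⟨Function.update r v n, ?_, fun x hx => ?_, fun x hx => ?_⟩
    · intro x hx y hy hxy
      by_cases hxv : x = v <;> by_cases hyv : y = v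
      · rw [hxv, hyv]
      · rw [hxv, Function.update_self, hupd y hyv] at hxy
        have := hlt y hy hyv
        omega
      · rw [hyv, Function.update_self, hupd x hxv] at hxy
        have := hlt x hx hxv
        omega
      · rw [hupd x hxv, hupd y hyv] at hxy
        exact hr1 (mem_coe.2 (mem_erase.2 ⟨hxv, hx⟩)) (mem_coe.2 (mem_erase.2 ⟨hyv, hy⟩)) hxy
    · by_cases hxv : x = v
      · rw [hxv, Function.update_self]
        omega
      · rw [hupd x hxv]
        have := hlt x hx hxv
        omega
    · by_cases hxv : x = v
      · subst hxv
        refine (card_le_card fun y hy => ?_).trans hv2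
        simp only [mem_filter, Function.update_self] at hy ⊢
        obtain ⟨hyR, hy1, w, hw1, hw2, hw3⟩ := hy
        have hyx : y ≠ x := by
          rintro rfl
          simp at hy1
        refine ⟨hyR, hyx, w, fun hwR => ?_, hw1, hw2⟩
        have := hw3.resolve_left (not_not.2 hwR)
        rw [hupd w hw2.ne] at this
        have := hlt w hwR hw2.ne
        omega
      · refine (card_le_card fun y hy => ?_).trans (hr3 x (mem_erase.2 ⟨hxv, hx⟩))
        simp only [mem_filter, mem_erase, hupd x hxv] at hy ⊢
        obtain ⟨hyR, hy1, w, hw1, hw2, hw3⟩ := hy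
        have hyv : y ≠ v := by
          rintro rfl
          rw [Function.update_self] at hy1
          have := hlt x hx hxv
          omega
        rw [hupd y hyv] at hy1
        refine ⟨⟨hyv, hyR⟩, hy1, w, hw1, hw2, ?_⟩
        -- The vertex `v` just placed lies outside `R.erase v`, so as a common neighbor it falls
        -- under the first alternative.
        by_cases hwv : w = v
        · exact Or.inl fun hw => hw.1 hwv
        · rw [hupd w hwv] at hw3
          exact hw3.imp (fun hw hw' => hw hw'.2) id

theorem PairBound.isArrangeable [Finite V] (h : PairBound G c) :
    IsArrangeable G (arrangeabilityBound c) := by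
  have := Fintype.ofFinite V
  obtain ⟨r, hr1, -, hr3⟩ := h.exists_rank _ Finset.univ rfl (by simp)
  have hr : Function.Injective r := fun x y hxy => hr1 (by simp) (by simp) hxy
  refine ⟨LinearOrder.lift' r hr, fun v => ?_⟩
  refine le_trans ?_ (hr3 v (mem_univ v))
  rw [← Set.ncard_coe_finset]
  refine Set.ncard_le_ncard (fun x hx => ?_) (Set.toFinite _)
  obtain ⟨hx1, w, hw, hx2⟩ := hx
  have hxv : r x < r v := hx1
  have hvw : r v < r w := hx2
  rw [SimpleGraph.mem_commonNeighbors] at hw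
  simp only [coe_filter, Set.mem_ofPred_eq, mem_univ, true_and]
  exact ⟨hxv, w, hw.1.symm, hw.2.symm, Or.inr hvw⟩

end Counting

/-! ### Maximum average degree and `ρ` -/

section MaxAverageDegree

variable {V : Type u} {G : SimpleGraph V}

theorem averageDegree_le_maxAverageDegree [Finite V] (H : G.Subgraph) (hH : H.verts.Nonempty) :
    averageDegree H ≤ maxAverageDegree G := by
  refine le_csSup (Set.Finite.bddAbove ?_) ⟨H, hH, rfl⟩
  have : Finite G.Subgraph := Finite.of_injective
    (fun H : G.Subgraph => (H.verts, H.Adj)) fun H K h => by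
      simp only [Prod.mk.injEq] at h
      exact SimpleGraph.Subgraph.ext h.1 h.2
  refine (Set.finite_range fun H : G.Subgraph => averageDegree H).subset ?_
  rintro d ⟨H, -, rfl⟩
  exact ⟨H, rfl⟩

theorem maxAverageDegree_le [Finite V] {b : ℝ} (hb : 0 ≤ b)
    (h : ∀ H : G.Subgraph, 2 * (H.edgeSet.ncard : ℝ) ≤ b * (H.verts.ncard : ℝ)) :
    maxAverageDegree G ≤ b := by
  refine Real.sSup_le ?_ hb
  rintro d ⟨H, hH, rfl⟩
  have : 0 < H.verts.ncard := (Set.ncard_pos (Set.toFinite _)).2 hH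
  exact (div_le_iff₀ (by exact_mod_cast this)).2 (h H)

theorem NeighborhoodSystem.ncard_nbhd_le_rho [Finite V] (S : NeighborhoodSystem G) (v : V) :
    (S.nbhd v).ncard ≤ S.rho :=
  le_ciSup (f := fun v => (S.nbhd v).ncard) (Set.finite_range _).bddAbove v

end MaxAverageDegree

/-! ### Bounded arrangeability bounds `mad` linearly in `ρ` -/

section Arrangeable

open Finset Classical

variable {V : Type u} {G : SimpleGraph V} {k : ℕ}

theorem isArrangeable_of_arrangeability_le [Finite V] (h : arrangeability G ≤ k) :
    IsArrangeable G k := by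
  -- The infimum of an empty set of naturals would be `0`, so nonemptiness is needed for it to be
  -- attained.
  have hne : {k : ℕ | IsArrangeable G k}.Nonempty := by
    have := Fintype.ofFinite V
    have e := Fintype.equivFin V
    refine ⟨Nat.card V, LinearOrder.lift' e e.injective, fun v => ?_⟩
    exact Set.ncard_le_card _
  obtain ⟨L, hL⟩ := Nat.sInf_mem hne
  exact ⟨L, fun v => (hL v).trans h⟩

/-- Let `m` be the largest smaller neighbor of `v`. All the others precede `m` and share with it the
neighbor `v > m`, so there are at most `k` of them. -/
theorem card_back_neighbors_le [Fintype V] [L : LinearOrder V]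
    (hL : ∀ v : V, {x : V | x < v ∧ ∃ w ∈ G.commonNeighbors x v, v < w}.ncard ≤ k) (v : V) :
    (univ.filter fun w => w < v ∧ G.Adj w v).card ≤ k + 1 := by
  set B := univ.filter fun w => w < v ∧ G.Adj w v with hB
  rcases B.eq_empty_or_nonempty with h0 | hne
  · simp [h0]
  have hm := B.max'_mem hne
  rw [← card_erase_add_one hm, add_le_add_iff_right, ← Set.ncard_coe_finset]
  refine (Set.ncard_le_ncard (fun x hx => ?_) (Set.toFinite _)).trans (hL (B.max' hne))
  obtain ⟨hxm, hxB⟩ := mem_erase.1 (mem_coe.1 hx)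
  obtain ⟨-, hm1, hm2⟩ := mem_filter.1 hm
  exact ⟨lt_of_le_of_ne (B.le_max' x hxB) hxm, v, ⟨(mem_filter.1 hxB).2.2, hm2⟩, hm1⟩

theorem ncard_edgeSet_le_of_back_pairs [Fintype V] [L : LinearOrder V] {K : SimpleGraph V}
    (H : K.Subgraph) (b : ℕ) (hb : ∀ v, (univ.filter fun u => u < v ∧ K.Adj u v).card ≤ b) :
    H.edgeSet.ncard ≤ b * H.verts.ncard := by
  set T : Finset (V × V) := H.verts.toFinset.biUnion fun v =>
    (univ.filter fun u => u < v ∧ K.Adj u v).image fun u => (u, v) with hT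
  have h1 : H.edgeSet ⊆ (T.image fun p => s(p.1, p.2) : Finset (Sym2 V)) := by
    intro e he
    induction e with
    | _ x y =>
    have hxy : H.Adj x y := he
    rw [mem_coe, mem_image]
    have key : ∀ x y, H.Adj x y → x < y → (x, y) ∈ T := by
      intro x y hxy hlt
      rw [hT, mem_biUnion]
      exact ⟨y, Set.mem_toFinset.2 hxy.snd_mem, mem_image_of_mem _
        (mem_filter.2 ⟨mem_univ _, hlt, hxy.adj_sub⟩)⟩
    rcases lt_or_gt_of_ne hxy.ne with hlt | hlt
    · exact ⟨(x, y), key x y hxy hlt, rfl⟩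
    · exact ⟨(y, x), key y x hxy.symm hlt, Sym2.eq_swap⟩
  calc _ ≤ (T.image fun p => s(p.1, p.2)).card := by
        rw [← Set.ncard_coe_finset]
        exact Set.ncard_le_ncard h1 (Set.toFinite _)
    _ ≤ T.card := card_image_le
    _ ≤ H.verts.toFinset.card * b :=
        card_biUnion_le_card_mul _ _ _ fun v _ => card_image_le.trans (hb v)
    _ = _ := by rw [← Set.ncard_eq_toFinset_card', mul_comm]

theorem IsArrangeable.mad_le [Finite V] (h : IsArrangeable G k) (S : NeighborhoodSystem G) :
    S.mad ≤ (4 * k + 2 : ℝ) * (S.rho : ℝ) := by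
  have := Fintype.ofFinite V
  obtain ⟨L, hL⟩ := h
  refine maxAverageDegree_le (by positivity) fun H => ?_
  have hb : ∀ v, (univ.filter fun u => u < v ∧ S.toGraph.Adj u v).card ≤
      k * S.rho + (k + 1) * S.rho := by
    intro v
    -- The estimate `k ≤ k * ρ` needs `ρ > 0`; for `ρ = 0` the graph `G_Σ` has no edges.
    rcases Nat.eq_zero_or_pos S.rho with h0 | hpos
    · rw [h0, mul_zero, mul_zero, add_zero, Nat.le_zero, card_eq_zero, filter_eq_empty_iff]
      rintro u - ⟨-, -, w, -, hs⟩
      have hw := S.ncard_nbhd_le_rho w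
      rw [h0, Nat.le_zero, Set.ncard_eq_zero (Set.toFinite _)] at hw
      simpa [hw] using hs (Set.mem_insert _ _)
    have hsub : (univ.filter fun u => u < v ∧ S.toGraph.Adj u v) ⊆
        (univ.filter fun x => x < v ∧ ∃ w ∈ G.commonNeighbors x v, v < w) ∪
          (univ.filter fun w => w < v ∧ G.Adj w v).biUnion fun w => (S.nbhd w).toFinset := by
      intro u hu
      obtain ⟨-, huv, -, w, hw, hs⟩ := mem_filter.1 hu
      have hvw : G.Adj v w := hw.2
      rcases lt_or_gt_of_ne hvw.ne with hlt | hlt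
      · exact mem_union_left _ (mem_filter.2 ⟨mem_univ _, huv, w, hw, hlt⟩)
      · refine mem_union_right _ (mem_biUnion.2 ⟨w, mem_filter.2 ⟨mem_univ _, hlt, hvw.symm⟩, ?_⟩)
        exact Set.mem_toFinset.2 (hs (Set.mem_insert _ _))
    refine (card_le_card hsub).trans ((card_union_le _ _).trans (add_le_add ?_ ?_))
    · refine le_trans ?_ ((hL v).trans (Nat.le_mul_of_pos_right k hpos))
      rw [← Set.ncard_coe_finset]
      exact Set.ncard_le_ncard (fun x hx => (mem_filter.1 (mem_coe.1 hx)).2) (Set.toFinite _)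
    · refine (card_biUnion_le_card_mul _ _ S.rho fun w _ => ?_).trans
        (Nat.mul_le_mul_right _ (card_back_neighbors_le hL v))
      rw [← Set.ncard_eq_toFinset_card']
      exact S.ncard_nbhd_le_rho w
  have hE := ncard_edgeSet_le_of_back_pairs H _ hb
  have hE' : (H.edgeSet.ncard : ℝ) ≤
      ((k : ℝ) * S.rho + (k + 1) * S.rho) * (H.verts.ncard : ℝ) := by exact_mod_cast hE
  linarith

end Arrangeable

/-! ### From systems with `ρ = 2` to the pair bound -/

section Pairs

open Finset Classical

variable {V : Type u} {G : SimpleGraph V}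

theorem card_le_two_mul_card_image_sym2 (T : Finset (V × V)) :
    T.card ≤ 2 * (T.image fun p => s(p.1, p.2)).card := by
  refine card_le_mul_card_image T 2 fun e he => ?_
  obtain ⟨q, -, rfl⟩ := mem_image.1 he
  refine (card_le_card (t := {q, q.swap}) fun p hp => ?_).trans card_le_two
  rw [mem_insert, mem_singleton]
  exact Sym2.mk_eq_mk_iff.1 (mem_filter.1 hp).2

/-- The neighborhood system that consists of the pairs assigned to the vertices of `W`. -/
def pairSystem (W : Finset V) (f : V → V × V)
    (h : ∀ w ∈ W, G.Adj w (f w).1 ∧ G.Adj w (f w).2) : NeighborhoodSystem G where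
  nbhd w := {x | w ∈ W ∧ (x = (f w).1 ∨ x = (f w).2)}
  subset_neighborSet := by
    rintro w x ⟨hw, rfl | rfl⟩
    exacts [(h w hw).1, (h w hw).2]

theorem pairSystem_nbhd {W : Finset V} {f : V → V × V}
    (h : ∀ w ∈ W, G.Adj w (f w).1 ∧ G.Adj w (f w).2) {w : V} (hw : w ∈ W) :
    (pairSystem W f h).nbhd w = {(f w).1, (f w).2} := by
  ext x
  simp [pairSystem, hw]

theorem pairSystem_rho [Finite V] {W : Finset V} {f : V → V × V}
    (h : ∀ w ∈ W, G.Adj w (f w).1 ∧ G.Adj w (f w).2) (hne : ∀ w ∈ W, (f w).1 ≠ (f w).2)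
    (hW : W.Nonempty) : (pairSystem W f h).rho = 2 := by
  obtain ⟨w, hw⟩ := hW
  have : Nonempty V := ⟨w⟩
  refine le_antisymm (ciSup_le fun v => ?_) ?_
  · by_cases hv : v ∈ W
    · rw [pairSystem_nbhd h hv, Set.ncard_pair (hne v hv)]
    · have : (pairSystem W f h).nbhd v = ∅ := by
        ext x
        simp [pairSystem, hv]
      simp [this]
  · rw [← Set.ncard_pair (hne w hw), ← pairSystem_nbhd h hw]
    exact NeighborhoodSystem.ncard_nbhd_le_rho _ w

theorem pairBound_of_mad_le [Finite V] {c : ℕ}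
    (h : ∀ S : NeighborhoodSystem G, S.rho = 2 → S.mad ≤ c) : PairBound G c := by
  intro A W f hf hW
  -- An empty `W` would give a system with `ρ = 0`, to which `h` does not apply.
  rcases W.eq_empty_or_nonempty with rfl | hne
  · simp
  have hadj : ∀ w ∈ W, G.Adj w (f w).1 ∧ G.Adj w (f w).2 := fun w hw => (hW w hw).2.2.2
  set S := pairSystem W f hadj with hS
  have hS2 : S.mad ≤ c := h S (pairSystem_rho hadj (fun w hw => (hW w hw).1) hne)
  have hmem : ∀ w ∈ W, (f w).1 ∈ S.nbhd w ∧ (f w).2 ∈ S.nbhd w := fun w hw =>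
    ⟨⟨hw, Or.inl rfl⟩, ⟨hw, Or.inr rfl⟩⟩
  let H : S.toGraph.Subgraph :=
    { verts := A
      Adj := fun x y => x ∈ A ∧ y ∈ A ∧ S.toGraph.Adj x y
      adj_sub := fun h => h.2.2
      edge_vert := fun h => h.1
      symm := ⟨fun x y h => ⟨h.2.1, h.1, h.2.2.symm⟩⟩ }
  obtain ⟨w₀, hw₀⟩ := hne
  have hA : H.verts.Nonempty := ⟨(f w₀).1, (hW w₀ hw₀).2.1⟩
  have hle := (averageDegree_le_maxAverageDegree H hA).trans hS2
  have hv : H.verts.ncard = A.card := Set.ncard_coe_finset A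
  have hpos : (0 : ℝ) < A.card := by
    exact_mod_cast card_pos.2 ⟨_, (hW w₀ hw₀).2.1⟩
  rw [averageDegree, hv, div_le_iff₀ hpos] at hle
  have hsub : (((W.image f).image fun p => s(p.1, p.2) : Finset (Sym2 V)) : Set (Sym2 V)) ⊆
      H.edgeSet := by
    intro e he
    obtain ⟨p, hp, rfl⟩ := mem_image.1 (mem_coe.1 he)
    obtain ⟨w, hw, rfl⟩ := mem_image.1 hp
    obtain ⟨h1, h2, h3, h4, h5⟩ := hW w hw
    refine ⟨h2, h3, h1, w, ⟨h4.symm, h5.symm⟩, ?_⟩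
    exact Set.pair_subset (hmem w hw).1 (hmem w hw).2
  have h1 := Set.ncard_le_ncard hsub (Set.toFinite _)
  rw [Set.ncard_coe_finset] at h1
  -- An edge comes from at most two ordered pairs; this factor is exactly the `2` in the average
  -- degree, so `c` is not lost.
  have h2 := card_le_two_mul_card_image_sym2 (W.image f)
  rw [card_image_of_injOn hf] at h2
  have h3 : (W.card : ℝ) ≤ 2 * (H.edgeSet.ncard : ℝ) := by
    exact_mod_cast h2.trans (Nat.mul_le_mul_left 2 h1)
  exact_mod_cast h3.trans hle

end Pairs

/-! ### The equivalence -/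

theorem mainTheorem3 (F : Set FinGraph.{u}) :
    List.TFAE [
      ∃ C : ℝ, ∀ G ∈ F, ∀ S : NeighborhoodSystem G.graph, S.mad ≤ C * (S.rho : ℝ),
      ∃ f : ℕ → ℝ, ∀ G ∈ F, ∀ S : NeighborhoodSystem G.graph, S.mad ≤ f S.rho,
      BddAbove {d : ℝ | ∃ G ∈ F, ∃ S : NeighborhoodSystem G.graph, S.rho = 2 ∧ S.mad = d},
      HasBoundedArrangeability F] := by
  tfae_have 1 → 2 := fun ⟨C, hC⟩ => ⟨fun n => C * n, hC⟩
  tfae_have 2 → 3 := by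
    rintro ⟨f, hf⟩
    refine ⟨f 2, ?_⟩
    rintro d ⟨G, hG, S, hS, rfl⟩
    rw [← hS]
    exact hf G hG S
  tfae_have 3 → 4 := by
    rintro ⟨b, hb⟩
    refine ⟨arrangeabilityBound ⌈b⌉₊, fun G hG => ?_⟩
    have := G.finite
    refine Nat.sInf_le (PairBound.isArrangeable (pairBound_of_mad_le fun S hS => ?_))
    exact (hb ⟨G, hG, S, hS, rfl⟩).trans (Nat.le_ceil b)
  tfae_have 4 → 1 := by
    rintro ⟨k, hk⟩
    refine ⟨4 * k + 2, fun G hG S => ?_⟩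
    have := G.finite
    exact (isArrangeable_of_arrangeability_le (hk G hG)).mad_le S
  tfae_finish
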